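/- Let $\mathcal A$ be a unital $\mathbb C$-algebra with a linear functional $\varphi$, $\varphi(1_{\mathcal A})=1$, and let $\mathcal F$ be a (not necessarily unital) $\mathbb C$-algebra with a linear functional $\Phi$ and an $\mathcal A$-bimodule structure consistent with its multiplication. Let $\mathcal B=\mathcal A\oplus\mathcal F$ be the unital algebra with product $$(a_1+f_1)(a_2+f_2)=a_1a_2+(a_1f_2+f_1a_2+f_1f_2),$$ and put $\varphi(a+f):=\varphi(a)$, $\varphi'(a+f):=\Phi(f)$ for $a\in\mathcal A$, $f\in\mathcal F$. No positivity or traciality is assumed. Let $q\in\mathcal F$ satisfy $q^2=q$ and $\Phi(q)=1$, and suppose that $(\mathcal A,\{q\})$ is cyclic-antimonotone independent: for all $n\ge 1$, $a_0,\dots,a_n\in\mathcal A$ and $f_1,\dots,f_n$ in the (non-unital) subalgebra generated by $q$, $$\Phi(a_0f_1a_1f_2\cdots f_na_n)=\varphi(a_0a_n)\Big[\prod_{1\le i\le n-1}\varphi(a_i)\Big]\Phi(f_1f_2\cdots f_n).$$ Put $p:=1_{\mathcal B}-q$, and on the algebra $p\mathcal Bp$ with unit $p$ consider the functionals $\psi:=\varphi|_{p\mathcal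 Bp}$ and $\psi':=(\varphi+\varphi')|_{p\mathcal Bp}$. Let $(\mathcal A_i)_{i\in I}$ be subalgebras of $\mathcal A$ containing $1_{\mathcal A}$ that are free in $(\mathcal A,\varphi)$, i.e. $\varphi(a_1\cdots a_n)=0$ whenever $n\ge1$, $i_1\ne i_2\ne\cdots\ne i_n$ (neighbouring indices are distinct), $a_k\in\mathcal A_{i_k}$ and $\varphi(a_k)=0$ for all $k$. Then $\psi(p)=1$, $\psi'(p)=0$, and the family $(p\mathcal A_ip)_{i\in I}$ is infinitesimally free in $(p\mathcal Bp,\psi,\psi')$, in the following sense. Let $\mathcal C_i$ be the subalgebra of $p\mathcal Bp$ generated by the unit $p$ and $p\mathcal A_ip=\{pap: a\in\mathcal A_i\}$. Then for all $n\ge1$, all $i_1,\dots,i_n\in I$ with $i_1\ne i_2\ne\cdots\ne i_n$ and all $b_k\in\mathcal C_{i_k}$ with $\psi(b_k)=0$ ($1\le k\le n$), one has $\psi(b_1b_2\cdots b_n)=0$ and $$\psi'(b_1\cdots b_n)=\begin{cases}\Big[\prod_{k=1}^{(n-1)/2}\psi(b_kb_{n+1-k})\Big]\,\psi'(b_{(n+1)/2})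 & \text{if } n \text{ is odd and } i_k=i_{n+1-k}\text{ for all }k,\\[1ex] 0&\text{otherwise.}\end{cases}$$ -/

import Mathlib

noncomputable section

/-- `F` is an `A`-algebra (for a possibly noncommutative unital algebra `A`): the `A`-bimodule
structure of `F` is consistent with the multiplication of `F`. The bimodule structure itself is
given by `Module A F`, `Module Aᵐᵒᵖ F` and `SMulCommClass A Aᵐᵒᵖ F`, and `MulOpposite.op a • f`
is the right action `f a`. -/
class IsBimoduleAlgebra (A F : Type*) [Ring A] [NonUnitalRing F] [Module A F]
    [Module Aᵐᵒᵖ F] : Prop where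
  /-- `(a f) g = a (f g)` -/
  left_assoc : ∀ (a : A) (f g : F), (a • f) * g = a • (f * g)
  /-- `(f a) g = f (a g)` -/
  middle_assoc : ∀ (a : A) (f g : F), (MulOpposite.op a • f) * g = f * (a • g)
  /-- `f (g a) = (f g) a` -/
  right_assoc : ∀ (a : A) (f g : F), f * (MulOpposite.op a • g) = MulOpposite.op a • (f * g)

/-! ### The algebra `A ⊕ F` with the type B prime multiplication -/

/-- The vector space `A ⊕ F`, to be equipped with the multiplication
`(a₁, f₁) (a₂, f₂) = (a₁ a₂, a₁ f₂ + f₁ a₂ + f₁ f₂)`. -/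
@[ext]
structure BPrimeAlg (A F : Type*) where
  /-- the main term -/
  main : A
  /-- the perturbation term -/
  pert : F

namespace BPrimeAlg

section Additive

variable {A F : Type*} [Ring A] [NonUnitalRing F]

/-- `A ⊕ F` as a product of types; used to transport the vector space structure. -/
def equivProd (A F : Type*) : BPrimeAlg A F ≃ A × F where
  toFun x := (x.main, x.pert)
  invFun y := ⟨y.1, y.2⟩
  left_inv _ := rfl
  right_inv _ := rfl

instance : AddCommGroup (BPrimeAlg A F) := (equivProd A F).addCommGroup

instance [Algebra ℂ A] [Module ℂ F] : Module ℂ (BPrimeAlg A F) := (equivProd A F).module ℂ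

instance : One (BPrimeAlg A F) := ⟨⟨1, 0⟩⟩

instance [Module A F] [Module Aᵐᵒᵖ F] : Mul (BPrimeAlg A F) :=
  ⟨fun x y => ⟨x.main * y.main,
    x.main • y.pert + MulOpposite.op y.main • x.pert + x.pert * y.pert⟩⟩

@[simp] theorem zero_main : (0 : BPrimeAlg A F).main = 0 := rfl
@[simp] theorem zero_pert : (0 : BPrimeAlg A F).pert = 0 := rfl
@[simp] theorem one_main : (1 : BPrimeAlg A F).main = 1 := rfl
@[simp] theorem one_pert : (1 : BPrimeAlg A F).pert = 0 := rfl
@[simp] theorem add_main (x y : BPrimeAlg A F) : (x + y).main = x.main + y.main := rfl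
@[simp] theorem add_pert (x y : BPrimeAlg A F) : (x + y).pert = x.pert + y.pert := rfl
@[simp] theorem neg_main (x : BPrimeAlg A F) : (-x).main = -x.main := rfl
@[simp] theorem neg_pert (x : BPrimeAlg A F) : (-x).pert = -x.pert := rfl
@[simp] theorem sub_main (x y : BPrimeAlg A F) : (x - y).main = x.main - y.main := rfl
@[simp] theorem sub_pert (x y : BPrimeAlg A F) : (x - y).pert = x.pert - y.pert := rfl
@[simp] theorem smul_main [Algebra ℂ A] [Module ℂ F] (c : ℂ) (x : BPrimeAlg A F) :
    (c • x).main = c • x.main := rfl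
@[simp] theorem smul_pert [Algebra ℂ A] [Module ℂ F] (c : ℂ) (x : BPrimeAlg A F) :
    (c • x).pert = c • x.pert := rfl
@[simp] theorem mul_main [Module A F] [Module Aᵐᵒᵖ F] (x y : BPrimeAlg A F) :
    (x * y).main = x.main * y.main := rfl
@[simp] theorem mul_pert [Module A F] [Module Aᵐᵒᵖ F] (x y : BPrimeAlg A F) :
    (x * y).pert =
      x.main • y.pert + MulOpposite.op y.main • x.pert + x.pert * y.pert := rfl

end Additive

section Multiplicative

variable {A F : Type*} [Ring A] [NonUnitalRing F] [Module A F] [Module Aᵐᵒᵖ F]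
  [SMulCommClass A Aᵐᵒᵖ F] [IsBimoduleAlgebra A F]

instance : Ring (BPrimeAlg A F) :=
  { (inferInstance : AddCommGroup (BPrimeAlg A F)),
    (inferInstance : Mul (BPrimeAlg A F)),
    (inferInstance : One (BPrimeAlg A F)) with
    left_distrib := fun x y z => by
      ext
      · simp [mul_add]
      · simp only [mul_pert, add_main, add_pert, smul_add, mul_add, MulOpposite.op_add, add_smul]
        abel
    right_distrib := fun x y z => by
      ext
      · simp [add_mul]
      · simp only [mul_pert, add_main, add_pert, smul_add, add_mul, add_smul]
        abel
    zero_mul := fun x => by ext <;> simp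
    mul_zero := fun x => by ext <;> simp
    one_mul := fun x => by ext <;> simp
    mul_one := fun x => by ext <;> simp
    mul_assoc := fun x y z => by
      ext
      · simp [mul_assoc]
      · simp only [mul_pert, mul_main, smul_add, mul_add, add_mul, mul_smul, MulOpposite.op_mul,
          IsBimoduleAlgebra.left_assoc, IsBimoduleAlgebra.middle_assoc,
          IsBimoduleAlgebra.right_assoc, mul_assoc]
        rw [smul_comm x.main (MulOpposite.op z.main) y.pert]
        abel }

variable [Algebra ℂ A] [Module ℂ F] [SMulCommClass ℂ F F] [IsScalarTower ℂ F F]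
  [IsScalarTower ℂ A F] [IsScalarTower ℂ Aᵐᵒᵖ F]

instance : Algebra ℂ (BPrimeAlg A F) :=
  Algebra.ofModule
    (fun c x y => by
      ext
      · simp
      · have h : MulOpposite.op y.main • c • x.pert = c • MulOpposite.op y.main • x.pert := by
          rw [← algebraMap_smul Aᵐᵒᵖ c x.pert, ← mul_smul, ← Algebra.commutes c, mul_smul,
            algebraMap_smul]
        simp [smul_add, h, smul_mul_assoc])
    (fun c x y => by
      ext
      · simp
      · have h : x.main • c • y.pert = c • x.main • y.pert := by
          rw [← algebraMap_smul A c y.pert, ← mul_smul, ← Algebra.commutes c, mul_smul,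
            algebraMap_smul]
        simp [smul_add, h, mul_smul_comm])

end Multiplicative

section Functionals

variable {A F : Type*} [Ring A] [NonUnitalRing F]

/-- The embedding of `A` into `A ⊕ F`. -/
def inl (a : A) : BPrimeAlg A F := ⟨a, 0⟩

/-- The embedding of `F` into `A ⊕ F`. -/
def inr (f : F) : BPrimeAlg A F := ⟨0, f⟩

variable [Algebra ℂ A] [Module ℂ F]

/-- The functional `a + f ↦ φ(a)` on `A ⊕ F`, again denoted by `φ` in informal notation. -/
def phi (φ : A →ₗ[ℂ] ℂ) : BPrimeAlg A F →ₗ[ℂ] ℂ where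
  toFun x := φ x.main
  map_add' _ _ := by simp
  map_smul' _ _ := by simp

/-- The functional `φ' : a + f ↦ Φ(f)` on `A ⊕ F`. -/
def phi' (Φ : F →ₗ[ℂ] ℂ) : BPrimeAlg A F →ₗ[ℂ] ℂ where
  toFun x := Φ x.pert
  map_add' _ _ := by simp
  map_smul' _ _ := by simp

end Functionals

end BPrimeAlg

/-! ### Independences -/

/-- Freeness of a family of unital subalgebras of `(A, φ)`: `φ(a₁ ⋯ aₙ) = 0` whenever `n ≥ 1`, the
`aₖ ∈ Aᵢ₍ₖ₎` are centered and neighbouring indices are distinct. -/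
def IsFreeFamily {A I : Type*} [Ring A] [Algebra ℂ A] (φ : A →ₗ[ℂ] ℂ)
    (S : I → Subalgebra ℂ A) : Prop :=
  ∀ (n : ℕ), 0 < n → ∀ (i : Fin n → I) (a : Fin n → A),
    (∀ (k : ℕ) (hk : k + 1 < n), i ⟨k, by omega⟩ ≠ i ⟨k + 1, hk⟩) →
    (∀ k, a k ∈ S (i k)) → (∀ k, φ (a k) = 0) →
    φ (List.ofFn a).prod = 0

/-- `(B, φ, φ')` is an infinitesimal noncommutative probability space. -/
structure IsInfinitesimalNCPS {B : Type*} [Ring B] [Algebra ℂ B] (φ φ' : B →ₗ[ℂ] ℂ) : Prop where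
  map_one : φ 1 = 1
  map_one' : φ' 1 = 0

/-- Infinitesimal freeness of a family of unital subalgebras of `(B, φ, φ')`. The elements
`b₁, …, bₙ` are numbered from `0` here, so that `b_{n+1-k}` is `b k.rev` and the middle element
(for odd `n`) is the one with number `n / 2`. -/
def IsInfinitesimallyFree {B I : Type*} [Ring B] [Algebra ℂ B] (φ φ' : B →ₗ[ℂ] ℂ)
    (S : I → Subalgebra ℂ B) : Prop :=
  ∀ (n : ℕ) (hn : 0 < n) (i : Fin n → I) (b : Fin n → B),
    (∀ (k : ℕ) (hk : k + 1 < n), i ⟨k, by omega⟩ ≠ i ⟨k + 1, hk⟩) →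
    (∀ k, b k ∈ S (i k)) → (∀ k, φ (b k) = 0) →
    φ (List.ofFn b).prod = 0 ∧
    ((Odd n ∧ ∀ k, i k = i k.rev) →
      φ' (List.ofFn b).prod =
        (∏ k : Fin (n / 2), φ (b ⟨k, by omega⟩ * b (Fin.rev ⟨k, by omega⟩))) *
          φ' (b ⟨n / 2, by omega⟩)) ∧
    (¬ (Odd n ∧ ∀ k, i k = i k.rev) → φ' (List.ofFn b).prod = 0)

/-- Cyclic-antimonotone independence of a pair `(A₁, F₁)`:
`Φ(a₀ f₁ a₁ ⋯ f_m a_m) = φ(a₀ a_m) φ(a₁) ⋯ φ(a_{m-1}) Φ(f₁ ⋯ f_m)` for all `m = n + 1 ≥ 1`.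
The products are formed in `A ⊕ F`, where they lie in the summand `F`, on which
`BPrimeAlg.phi' Φ` is `Φ`. -/
def IsCyclicAntimonotone {A F : Type*} [Ring A] [Algebra ℂ A] [NonUnitalRing F] [Module ℂ F]
    [Module A F] [Module Aᵐᵒᵖ F] [SMulCommClass A Aᵐᵒᵖ F] [IsBimoduleAlgebra A F]
    (φ : A →ₗ[ℂ] ℂ) (Φ : F →ₗ[ℂ] ℂ)
    (A₁ : Subalgebra ℂ A) (F₁ : NonUnitalSubalgebra ℂ F) : Prop :=
  ∀ (n : ℕ) (a : Fin (n + 2) → A) (f : Fin (n + 1) → F),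
    (∀ k, a k ∈ A₁) → (∀ k, f k ∈ F₁) →
    BPrimeAlg.phi' Φ (BPrimeAlg.inl (a 0) *
        (List.ofFn fun k : Fin (n + 1) =>
          (BPrimeAlg.inr (f k) * BPrimeAlg.inl (a k.succ) : BPrimeAlg A F)).prod) =
      φ (a 0 * a (Fin.last (n + 1))) * (∏ k : Fin n, φ (a k.castSucc.succ)) *
        BPrimeAlg.phi' Φ (List.ofFn fun k => (BPrimeAlg.inr (f k) : BPrimeAlg A F)).prod

/-! ### The compressed space `p B p` -/

section Corner

variable {B : Type*} [Ring B] [Algebra ℂ B] {p : B} (hp : IsIdempotentElem p)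

instance : Module ℂ hp.Corner where
  smul c x := ⟨c • x.1, by
    obtain ⟨y, hy⟩ := x.2
    exact ⟨c • y, by simp [← hy]⟩⟩
  one_smul x := Subtype.ext (one_smul ℂ x.1)
  mul_smul c d x := Subtype.ext (mul_smul c d x.1)
  smul_zero c := Subtype.ext (smul_zero c)
  smul_add c x y := Subtype.ext (smul_add c x.1 y.1)
  add_smul c d x := Subtype.ext (add_smul c d x.1)
  zero_smul x := Subtype.ext (zero_smul ℂ x.1)

/-- `p B p` is a unital algebra with unit `p`. -/
instance : Algebra ℂ hp.Corner :=
  Algebra.ofModule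
    (fun c x y => Subtype.ext (smul_mul_assoc c x.1 y.1))
    (fun c x y => Subtype.ext (mul_smul_comm c x.1 y.1))

/-- The restriction to `p B p` of a linear functional on `B`. -/
def cornerRestrict (χ : B →ₗ[ℂ] ℂ) : hp.Corner →ₗ[ℂ] ℂ where
  toFun x := χ x.1
  map_add' x y := χ.map_add x.1 y.1
  map_smul' c x := χ.map_smul c x.1

/-- The unital subalgebra of `p B p` (with unit `p`) generated by `p S p = {p s p | s ∈ S}`. -/
def cornerSubalgebra (S : Set B) : Subalgebra ℂ hp.Corner :=
  Algebra.adjoin ℂ {x : hp.Corner | ∃ s ∈ S, x.1 = p * s * p}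

end Corner

/-- `p = 1 - q` is idempotent in `A ⊕ F` if `q` is idempotent in `F`. -/
theorem BPrimeAlg.isIdempotentElem_one_sub_inr {A F : Type*} [Ring A] [NonUnitalRing F]
    [Module A F] [Module Aᵐᵒᵖ F] [SMulCommClass A Aᵐᵒᵖ F] [IsBimoduleAlgebra A F]
    {q : F} (hq : q * q = q) :
    IsIdempotentElem (1 - BPrimeAlg.inr q : BPrimeAlg A F) := by
  apply IsIdempotentElem.one_sub
  ext <;> simp [BPrimeAlg.inr, hq]

end

/-! Write `p = 1 - q`. Cyclic-antimonotone independence does not give `q a q = φ(a) q` in `F`, only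
the same identity under `Φ` inside any word in `A` and `q`. The algebra generated by `A` and `q` is
therefore divided by the ideal of elements with zero `A`-part that `Φ` cannot detect. In the
quotient `q a q = φ(a) q` holds, and the induced functional `χ` satisfies `χ(a q b) = φ(ab)` and
`χ(a) = 0` (`isRankOneModel_nullMk`).

There a centered element of the `i`-th compressed algebra is `b = p a p + s`, with `a` centered in
`S i` and `s` in the span of the `u q v` with `u, v` centered in `S i`
(`exists_nullMk_eq_compress_add`); moreover `χ(b) = χ(s)`. In an alternating product `b₁ ⋯ bₙ`, each
term with two separated `q` contains `q w q` for a nonempty alternating centered word `w`, and `φ(w)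
= 0` by freeness. What remains is `a₁ ⋯ aₙ`, minus the words with one `q` inserted, plus the words
with one `aₖ` replaced by `sₖ` (`prod_compress_add`).

Under `χ` the first term is 0, and the second sum is `(n + 1) φ(a₁ ⋯ aₙ) = 0`. The third gives
`χ(sₖ)` times `φ` of the word with `aₖ` removed. Evaluating the latter outwards from the gap yields
0 unless the indices form a palindrome around `k`, when it is the product of the `φ(aⱼ aₙ₊₁₋ⱼ)`
(`map_wordProd_take_mul_drop`). The statement on `ψ` is freeness applied to the `A`-parts, since `p`
has `A`-part 1. -/

noncomputable section

/-! ### Alternating centered words in free subalgebras -/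

section Words

variable {A I : Type*} [Ring A]

/-- The product of the letters of a word. -/
def wordProd (L : List (I × A)) : A := (L.map Prod.snd).prod

@[simp] theorem wordProd_nil : wordProd ([] : List (I × A)) = 1 := rfl

@[simp] theorem wordProd_cons (x : I × A) (L : List (I × A)) :
    wordProd (x :: L) = x.2 * wordProd L := by simp [wordProd]

@[simp] theorem wordProd_append (L M : List (I × A)) :
    wordProd (L ++ M) = wordProd L * wordProd M := by simp [wordProd]

variable [Algebra ℂ A]

/-- The list of pairs `(i, a)` is an alternating word: neighbouring indices are distinct and every
letter is a centered element of the subalgebra that carries its index. -/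
structure IsAltWord (φ : A →ₗ[ℂ] ℂ) (S : I → Subalgebra ℂ A) (L : List (I × A)) : Prop where
  chain : (L.map Prod.fst).IsChain (· ≠ ·)
  mem : ∀ x ∈ L, x.2 ∈ S x.1
  centered : ∀ x ∈ L, φ x.2 = 0

variable {φ : A →ₗ[ℂ] ℂ} {S : I → Subalgebra ℂ A}

theorem IsAltWord.of_append_left {L M : List (I × A)} (h : IsAltWord φ S (L ++ M)) :
    IsAltWord φ S L where
  chain := by
    have := h.chain
    rw [List.map_append] at this
    exact this.left_of_append
  mem x hx := h.mem x (by simp [hx])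
  centered x hx := h.centered x (by simp [hx])

theorem IsAltWord.of_append_right {L M : List (I × A)} (h : IsAltWord φ S (L ++ M)) :
    IsAltWord φ S M where
  chain := by
    have := h.chain
    rw [List.map_append] at this
    exact this.right_of_append
  mem x hx := h.mem x (by simp [hx])
  centered x hx := h.centered x (by simp [hx])

theorem IsAltWord.of_cons {x : I × A} {L : List (I × A)} (h : IsAltWord φ S (x :: L)) :
    IsAltWord φ S L :=
  IsAltWord.of_append_right (L := [x]) h

/-- A letter of an alternating word may be replaced by a centered one of the same subalgebra. -/
theorem IsAltWord.replace {L M : List (I × A)} {i : I} {a b : A}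
    (h : IsAltWord φ S (L ++ (i, a) :: M)) (hb : b ∈ S i) (hb0 : φ b = 0) :
    IsAltWord φ S (L ++ (i, b) :: M) where
  chain := by simpa using h.chain
  mem x hx := by
    rcases List.mem_append.1 hx with hx | hx
    · exact h.mem x (by simp [hx])
    · rcases List.mem_cons.1 hx with rfl | hx
      · exact hb
      · exact h.mem x (by simp [hx])
  centered x hx := by
    rcases List.mem_append.1 hx with hx | hx
    · exact h.centered x (by simp [hx])
    · rcases List.mem_cons.1 hx with rfl | hx
      · exact hb0
      · exact h.centered x (by simp [hx])

theorem IsFreeFamily.wordProd_eq_zero (hfree : IsFreeFamily φ S) {L : List (I × A)}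
    (h : IsAltWord φ S L) (hL : L ≠ []) : φ (wordProd L) = 0 := by
  have := hfree L.length (List.length_pos_iff.2 hL) (fun k => (L.get k).1) (fun k => (L.get k).2)
    (fun k hk => by
      have := List.isChain_iff_getElem.1 h.chain k (by simpa using hk)
      simpa using this)
    (fun k => h.mem _ (List.get_mem _ _)) (fun k => h.centered _ (List.get_mem _ _))
  have e : L.map Prod.snd = List.ofFn (fun k => (L.get k).2) := by
    apply List.ext_getElem <;> simp
  rw [wordProd, e]
  exact this

/-- The centered part of an element is centered. -/
theorem map_sub_algebraMap (hφ : φ 1 = 1) (a : A) : φ (a - algebraMap ℂ A (φ a)) = 0 := by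
  simp [Algebra.algebraMap_eq_smul_one, hφ]

theorem sub_algebraMap_mem {T : Subalgebra ℂ A} {a : A} (ha : a ∈ T) (c : ℂ) :
    a - algebraMap ℂ A c ∈ T :=
  T.sub_mem ha (T.algebraMap_mem c)

/-- Replacing a letter of an alternating word by an arbitrary element of its subalgebra. -/
theorem IsFreeFamily.map_wordProd_mul_mul (hφ : φ 1 = 1) (hfree : IsFreeFamily φ S)
    {L M : List (I × A)} {i : I} {a b : A}
    (h : IsAltWord φ S (L ++ (i, a) :: M)) (hb : b ∈ S i) :
    φ (wordProd L * b * wordProd M) = φ b * φ (wordProd L * wordProd M) := by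
  -- The letter `a` only marks the index; freeness is applied with `b - φ(b)` in its place.
  have h0 := hfree.wordProd_eq_zero
    (h.replace (sub_algebraMap_mem hb (φ b)) (map_sub_algebraMap hφ b)) (by simp)
  simp only [wordProd_append, wordProd_cons, sub_mul, mul_sub, map_sub, sub_eq_zero,
    Algebra.algebraMap_eq_smul_one, smul_mul_assoc, one_mul, mul_smul_comm, map_smul,
    smul_eq_mul] at h0
  rw [mul_assoc, h0]

theorem IsAltWord.reverse_append {P Q : List (I × A)} {x y : I × A}
    (hP : IsAltWord φ S (x :: P)) (hQ : IsAltWord φ S (y :: Q)) (hxy : x.1 ≠ y.1) :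
    IsAltWord φ S ((x :: P).reverse ++ y :: Q) where
  chain := by
    rw [List.map_append, List.isChain_append]
    refine ⟨?_, hQ.chain, ?_⟩
    · rw [List.map_reverse, List.isChain_reverse]
      exact hP.chain.imp fun _ _ h => h.symm
    · simp [hxy]
  mem z hz := by
    rcases List.mem_append.1 hz with hz | hz
    · exact hP.mem z (List.mem_reverse.1 hz)
    · exact hQ.mem z hz
  centered z hz := by
    rcases List.mem_append.1 hz with hz | hz
    · exact hP.centered z (List.mem_reverse.1 hz)
    · exact hQ.centered z hz

theorem IsAltWord.reverse {P : List (I × A)} (hP : IsAltWord φ S P) :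
    IsAltWord φ S P.reverse where
  chain := by
    rw [List.map_reverse, List.isChain_reverse]
    exact hP.chain.imp fun _ _ h => h.symm
  mem z hz := hP.mem z (List.mem_reverse.1 hz)
  centered z hz := hP.centered z (List.mem_reverse.1 hz)

/-- The two innermost letters share an index, so their product is one letter of the same subalgebra;
`x` is a placeholder for it, to be exchanged by `map_wordProd_mul_mul`. -/
theorem IsAltWord.reverse_append_cons {P Q : List (I × A)} {x y : I × A}
    (hP : IsAltWord φ S (x :: P)) (hQ : IsAltWord φ S (y :: Q)) (hxy : x.1 = y.1) :
    IsAltWord φ S (P.reverse ++ x :: Q) := by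
  refine ⟨?_, fun z hz => ?_, fun z hz => ?_⟩
  · rw [List.map_append, List.map_cons, List.isChain_split]
    constructor
    · have := hP.reverse.chain
      simpa using this
    · have := hQ.chain
      simpa [hxy] using this
  · rcases List.mem_append.1 hz with hz | hz
    · exact hP.mem z (by simp [List.mem_reverse.1 hz])
    · rcases List.mem_cons.1 hz with rfl | hz
      · exact hP.mem z (by simp)
      · exact hQ.mem z (by simp [hz])
  · rcases List.mem_append.1 hz with hz | hz
    · exact hP.centered z (by simp [List.mem_reverse.1 hz])
    · rcases List.mem_cons.1 hz with rfl | hz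
      · exact hP.centered z (by simp)
      · exact hQ.centered z (by simp [hz])

open Classical in
/-- The value of `φ` on the product of two alternating words, the first of which is read
backwards. -/
theorem IsFreeFamily.map_wordProd_reverse_mul (hφ : φ 1 = 1) (hfree : IsFreeFamily φ S) :
    ∀ {P Q : List (I × A)}, IsAltWord φ S P → IsAltWord φ S Q →
      φ (wordProd P.reverse * wordProd Q) =
        if P.map Prod.fst = Q.map Prod.fst then
          (List.zipWith (fun x y => φ (x.2 * y.2)) P Q).prod else 0
  | [], [], _, _ => by simp [hφ]
  | [], y :: Q, _, hQ => by
    simpa using hfree.wordProd_eq_zero hQ (by simp)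
  | x :: P, [], hP, _ => by
    simpa using hfree.wordProd_eq_zero hP.reverse (by simp)
  | x :: P, y :: Q, hP, hQ => by
    by_cases hxy : x.1 = y.1
    -- Reading `P` backwards makes the heads `x` and `y` meet at the centre; their product splits
    -- off as `φ(x y)` and the tails remain.
    · have h1 := hP.reverse_append_cons hQ hxy
      have h2 := hfree.map_wordProd_mul_mul hφ (i := x.1) (a := x.2) (b := x.2 * y.2) h1
        ((S x.1).mul_mem (hP.mem x (by simp)) (hxy ▸ hQ.mem y (by simp)))
      have h3 := hfree.map_wordProd_reverse_mul hφ hP.of_cons hQ.of_cons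
      rw [h3] at h2
      have e : wordProd (x :: P).reverse * wordProd (y :: Q) =
          wordProd P.reverse * (x.2 * y.2) * wordProd Q := by
        simp [mul_assoc]
      rw [e, h2]
      simp [hxy]
    · rw [← wordProd_append, hfree.wordProd_eq_zero (hP.reverse_append hQ hxy) (by simp)]
      simp [hxy]

end Words

/-! ### Adjoining an idempotent that compresses `A` to the scalars -/

section RankOne

variable {A R I : Type*} [Ring A] [Algebra ℂ A] [Ring R] [Algebra ℂ R]

/-- The element `q` of `R` is an idempotent with `q a q = φ(a) q` for `a` in the image of `A`, and
the functional `χ` is given by `χ(a q b) = φ(ab)` and vanishes on `A`. -/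
structure IsRankOneModel (φ : A →ₗ[ℂ] ℂ) (ι : A →ₐ[ℂ] R) (q : R) (χ : R →ₗ[ℂ] ℂ) : Prop where
  idem : q * q = q
  sandwich : ∀ a, q * ι a * q = φ a • q
  map_base : ∀ a, χ (ι a) = 0
  trace : ∀ a b, χ (ι a * q * ι b) = φ (a * b)

/-- The span of the elements `u q v` with centered `u, v` in the subalgebra `T`. -/
def centeredSpan (φ : A →ₗ[ℂ] ℂ) (ι : A →ₐ[ℂ] R) (q : R) (T : Subalgebra ℂ A) :
    Submodule ℂ R :=
  Submodule.span ℂ {x | ∃ u ∈ T, ∃ v ∈ T, φ u = 0 ∧ φ v = 0 ∧ x = ι u * q * ι v}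

/-- The compression `(1 - q) a (1 - q)` of a centered element `a`. -/
def compress (ι : A →ₐ[ℂ] R) (q : R) (a : A) : R := ι a - q * ι a - ι a * q

/-- The sum of the words that arise from `a₁ ⋯ aₙ` by the insertion of one letter `q`. -/
def insertSum (ι : A →ₐ[ℂ] R) (q : R) : List (I × A) → R
  | [] => q
  | x :: M => q * ι (x.2 * wordProd M) + ι x.2 * insertSum ι q M

/-- The sum of the words that arise from `a₁ ⋯ aₙ` by the replacement of one letter `aₖ` by
`sₖ`. -/
def replaceSum (ι : A →ₐ[ℂ] R) : List ((I × A) × R) → R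
  | [] => 0
  | x :: L => x.2 * ι (wordProd (L.map Prod.fst)) + ι x.1.2 * replaceSum ι L

variable {φ : A →ₗ[ℂ] ℂ} {ι : A →ₐ[ℂ] R} {q : R} {χ : R →ₗ[ℂ] ℂ} {S : I → Subalgebra ℂ A}
  {T : Subalgebra ℂ A}

/-! ### Products of compressions and of elements of `centeredSpan` -/

namespace IsRankOneModel

theorem idem_assoc (h : IsRankOneModel φ ι q χ) (x : R) : q * (q * x) = q * x := by
  rw [← mul_assoc, h.idem]

theorem sandwich' (h : IsRankOneModel φ ι q χ) (a : A) : q * (ι a * q) = φ a • q := by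
  rw [← mul_assoc, h.sandwich]

theorem sandwich_assoc (h : IsRankOneModel φ ι q χ) (a : A) (x : R) :
    q * (ι a * (q * x)) = φ a • (q * x) := by
  rw [← mul_assoc, ← mul_assoc, h.sandwich, smul_mul_assoc]

theorem trace_left (h : IsRankOneModel φ ι q χ) (a : A) : χ (q * ι a) = φ a := by
  simpa using h.trace 1 a

theorem trace_right (h : IsRankOneModel φ ι q χ) (a : A) : χ (ι a * q) = φ a := by
  simpa using h.trace a 1

theorem map_compress (h : IsRankOneModel φ ι q χ) {a : A} (ha : φ a = 0) :
    χ (compress ι q a) = 0 := by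
  simp [compress, h.trace_left, h.trace_right, h.map_base, ha]

theorem mul_centered_eq_zero (h : IsRankOneModel φ ι q χ) {s : R}
    (hs : s ∈ centeredSpan φ ι q T) : q * s = 0 := by
  induction hs using Submodule.span_induction with
  | mem x hx =>
    obtain ⟨u, -, v, -, hu, -, rfl⟩ := hx
    simp [mul_assoc, h.sandwich_assoc, hu]
  | zero => simp
  | add x y _ _ hx hy => rw [mul_add, hx, hy, add_zero]
  | smul c x _ hx => rw [mul_smul_comm, hx, smul_zero]

theorem centered_mul_eq_zero (h : IsRankOneModel φ ι q χ) {s : R}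
    (hs : s ∈ centeredSpan φ ι q T) : s * q = 0 := by
  induction hs using Submodule.span_induction with
  | mem x hx =>
    obtain ⟨u, -, v, -, -, hv, rfl⟩ := hx
    simp [mul_assoc, h.sandwich', hv]
  | zero => simp
  | add x y _ _ hx hy => rw [add_mul, hx, hy, add_zero]
  | smul c x _ hx => rw [smul_mul_assoc, hx, smul_zero]

/-- On a generator, `(a - q a - a q) u q v = (a u - φ(a u)) q v`: the term `q a u q` supplies the
centering and `q u q = 0` removes the last one. -/
theorem compress_mul_mem (h : IsRankOneModel φ ι q χ) (hφ : φ 1 = 1) {a : A} (ha : a ∈ T) {s : R}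
    (hs : s ∈ centeredSpan φ ι q T) : compress ι q a * s ∈ centeredSpan φ ι q T := by
  induction hs using Submodule.span_induction with
  | mem x hx =>
    obtain ⟨u, hu, v, hv, hu0, hv0, rfl⟩ := hx
    refine Submodule.subset_span ⟨a * u - algebraMap ℂ A (φ (a * u)),
      sub_algebraMap_mem (T.mul_mem ha hu) _, v, hv, map_sub_algebraMap hφ _, hv0, ?_⟩
    have e := h.sandwich_assoc (a * u) (ι v)
    rw [map_mul, mul_assoc] at e
    simp only [compress, map_sub, map_mul, sub_mul, mul_assoc, h.sandwich_assoc, hu0, e,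
      Algebra.algebraMap_eq_smul_one, map_smul, map_one, smul_mul_assoc, one_mul, zero_smul,
      mul_zero, sub_zero]
  | zero => simp
  | add x y _ _ hx hy => rw [mul_add]; exact add_mem hx hy
  | smul c x _ hx => rw [mul_smul_comm]; exact Submodule.smul_mem _ _ hx

theorem mul_compress_mem (h : IsRankOneModel φ ι q χ) (hφ : φ 1 = 1) {a : A} (ha : a ∈ T) {s : R}
    (hs : s ∈ centeredSpan φ ι q T) : s * compress ι q a ∈ centeredSpan φ ι q T := by
  induction hs using Submodule.span_induction with
  | mem x hx =>
    obtain ⟨u, hu, v, hv, hu0, hv0, rfl⟩ := hx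
    refine Submodule.subset_span ⟨u, hu, v * a - algebraMap ℂ A (φ (v * a)),
      sub_algebraMap_mem (T.mul_mem hv ha) _, hu0, map_sub_algebraMap hφ _, ?_⟩
    have e := h.sandwich' (v * a)
    rw [map_mul, mul_assoc] at e
    simp only [compress, map_sub, map_mul, mul_sub, mul_assoc, h.sandwich_assoc, hv0, e,
      Algebra.algebraMap_eq_smul_one, map_smul, map_one, mul_smul_comm, mul_one, zero_smul,
      mul_zero, sub_zero]
  | zero => simp
  | add x y _ _ hx hy => rw [add_mul]; exact add_mem hx hy
  | smul c x _ hx => rw [smul_mul_assoc]; exact Submodule.smul_mem _ _ hx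

theorem mul_mem_centeredSpan (h : IsRankOneModel φ ι q χ) {s t : R}
    (hs : s ∈ centeredSpan φ ι q T) (ht : t ∈ centeredSpan φ ι q T) :
    s * t ∈ centeredSpan φ ι q T := by
  induction hs using Submodule.span_induction with
  | mem x hx =>
    obtain ⟨u, hu, v, hv, hu0, hv0, rfl⟩ := hx
    induction ht using Submodule.span_induction with
    | mem y hy =>
      obtain ⟨u', hu', v', hv', hu0', hv0', rfl⟩ := hy
      have e : ι u * q * ι v * (ι u' * q * ι v') = φ (v * u') • (ι u * q * ι v') := by
        have := h.sandwich_assoc (v * u') (ι v')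
        rw [map_mul, mul_assoc] at this
        simp only [mul_assoc, this, mul_smul_comm]
      rw [e]
      exact Submodule.smul_mem _ _ (Submodule.subset_span ⟨u, hu, v', hv', hu0, hv0', rfl⟩)
    | zero => simp
    | add x y _ _ hx hy => rw [mul_add]; exact add_mem hx hy
    | smul c x _ hx => rw [mul_smul_comm]; exact Submodule.smul_mem _ _ hx
  | zero => simp
  | add x y _ _ hx hy => rw [add_mul]; exact add_mem hx hy
  | smul c x _ hx => rw [smul_mul_assoc]; exact Submodule.smul_mem _ _ hx

/-- This is `p a p b p = p ab p - p a q b p`, where `p a q b p = a q b` because `q a q = q b q = 0`.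
-/
theorem compress_mul_compress (h : IsRankOneModel φ ι q χ) {a b : A}
    (ha : φ a = 0) (hb : φ b = 0) :
    compress ι q a * compress ι q b = φ (a * b) • (1 - q) +
      compress ι q (a * b - algebraMap ℂ A (φ (a * b))) - ι a * q * ι b := by
  have e := h.sandwich' (a * b)
  rw [map_mul, mul_assoc] at e
  simp only [compress, map_sub, map_mul, sub_mul, mul_sub, mul_assoc, h.sandwich_assoc,
    h.sandwich', h.idem_assoc, e, ha, hb, Algebra.algebraMap_eq_smul_one, map_smul,
    map_one, mul_smul_comm, smul_mul_assoc, mul_one, one_mul, zero_smul, mul_zero, sub_zero]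
  module

end IsRankOneModel

/-- The elements `c (1 - q) + (1 - q) a (1 - q) + s` with a centered element `a` of `T` and a linear
combination `s` of elements `u q v` with centered `u, v` in `T`. -/
def IsCornerForm (φ : A →ₗ[ℂ] ℂ) (ι : A →ₐ[ℂ] R) (q : R) (T : Subalgebra ℂ A) (x : R) : Prop :=
  ∃ (c : ℂ) (a : A) (s : R), a ∈ T ∧ φ a = 0 ∧ s ∈ centeredSpan φ ι q T ∧
    x = c • (1 - q) + compress ι q a + s

namespace IsCornerForm

theorem smul_one_sub (c : ℂ) : IsCornerForm φ ι q T (c • (1 - q)) :=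
  ⟨c, 0, 0, T.zero_mem, map_zero φ, Submodule.zero_mem _, by simp [compress]⟩

theorem conj (h : IsRankOneModel φ ι q χ) (hφ : φ 1 = 1) {a : A} (ha : a ∈ T) :
    IsCornerForm φ ι q T ((1 - q) * ι a * (1 - q)) := by
  refine ⟨φ a, a - algebraMap ℂ A (φ a), 0, sub_algebraMap_mem ha _, map_sub_algebraMap hφ a,
    Submodule.zero_mem _, ?_⟩
  simp only [compress, map_sub, sub_mul, mul_sub, mul_assoc, h.sandwich',
    Algebra.algebraMap_eq_smul_one, map_smul, map_one, mul_smul_comm, smul_mul_assoc, mul_one,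
    one_mul]
  module

theorem add {x y : R} (hx : IsCornerForm φ ι q T x) (hy : IsCornerForm φ ι q T y) :
    IsCornerForm φ ι q T (x + y) := by
  obtain ⟨c, a, s, ha, ha0, hs, rfl⟩ := hx
  obtain ⟨d, b, t, hb, hb0, ht, rfl⟩ := hy
  refine ⟨c + d, a + b, s + t, T.add_mem ha hb, by simp [ha0, hb0], add_mem hs ht, ?_⟩
  simp only [compress, map_add, mul_add, add_mul]
  module

/-- Closure under products is what makes this form valid on the whole generated algebra. Only the
product of two compressions yields something new: a scalar `φ(ab)` and a term `-a q b` of the span.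
-/
theorem mul (h : IsRankOneModel φ ι q χ) (hφ : φ 1 = 1) {x y : R} (hx : IsCornerForm φ ι q T x)
    (hy : IsCornerForm φ ι q T y) : IsCornerForm φ ι q T (x * y) := by
  obtain ⟨c, a, s, ha, ha0, hs, rfl⟩ := hx
  obtain ⟨d, b, t, hb, hb0, ht, rfl⟩ := hy
  refine ⟨c * d + φ (a * b), c • b + d • a + (a * b - algebraMap ℂ A (φ (a * b))),
    c • t + d • s - ι a * q * ι b + compress ι q a * t + s * compress ι q b + s * t,
    add_mem (add_mem (T.smul_mem hb c) (T.smul_mem ha d))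
      (sub_algebraMap_mem (T.mul_mem ha hb) _), ?_, ?_, ?_⟩
  · rw [map_add, map_sub_algebraMap hφ]
    simp [ha0, hb0]
  · refine add_mem (add_mem (add_mem (sub_mem (add_mem ?_ ?_) ?_) ?_) ?_) ?_
    · exact Submodule.smul_mem _ _ ht
    · exact Submodule.smul_mem _ _ hs
    · exact Submodule.subset_span ⟨a, ha, b, hb, ha0, hb0, rfl⟩
    · exact h.compress_mul_mem hφ ha ht
    · exact h.mul_compress_mem hφ hb hs
    · exact h.mul_mem_centeredSpan hs ht
  · have h1 : (1 - q) * compress ι q b = compress ι q b := by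
      simp only [compress, sub_mul, mul_sub, one_mul, h.idem_assoc, h.sandwich', hb0]
      simp
    have h2 : compress ι q a * (1 - q) = compress ι q a := by
      simp only [compress, sub_mul, mul_sub, mul_one, mul_assoc, h.idem, h.sandwich', ha0]
      simp
    have h3 : (1 - q) * t = t := by
      rw [sub_mul, one_mul, h.mul_centered_eq_zero ht, sub_zero]
    have h4 : s * (1 - q) = s := by
      rw [mul_sub, mul_one, h.centered_mul_eq_zero hs, sub_zero]
    have h5 : (1 - q) * (1 - q) = 1 - q := by
      simp [mul_sub, sub_mul, h.idem]
    have h6 := h.compress_mul_compress ha0 hb0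
    have h7 : compress ι q (c • b + d • a + (a * b - algebraMap ℂ A (φ (a * b)))) =
        c • compress ι q b + d • compress ι q a +
          compress ι q (a * b - algebraMap ℂ A (φ (a * b))) := by
      simp only [compress, map_add, map_smul, mul_add, add_mul, mul_smul_comm, smul_mul_assoc]
      module
    simp only [add_mul, mul_add, smul_mul_assoc, mul_smul_comm, h1, h2, h3, h4, h5, h6, h7]
    module

end IsCornerForm

/-! ### Expansion of alternating products and their values under `χ` -/

namespace IsRankOneModel

/-- The leading `q` and the inserted one enclose `V` followed by a prefix of `M`, an alternating
word on which `φ` vanishes. Nonemptiness of `V` excludes the surviving `q q`. -/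
theorem wordProd_mul_insertSum (h : IsRankOneModel φ ι q χ) (hfree : IsFreeFamily φ S) :
    ∀ {M V : List (I × A)}, IsAltWord φ S (V ++ M) → V ≠ [] →
      q * (ι (wordProd V) * insertSum ι q M) = 0
  | [], V, hV, hne => by
    rw [insertSum, h.sandwich', hfree.wordProd_eq_zero hV.of_append_left hne, zero_smul]
  | x :: M, V, hV, hne => by
    have e := h.wordProd_mul_insertSum hfree (M := M) (V := V ++ [x]) (by simpa using hV) (by simp)
    simp only [wordProd_append, wordProd_cons, wordProd_nil, mul_one, map_mul, mul_assoc] at e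
    rw [insertSum, mul_add, mul_add, e, h.sandwich_assoc,
      hfree.wordProd_eq_zero hV.of_append_left hne, zero_smul, add_zero]

/-- Only the insertion in front of the first letter escapes the vanishing, since there `q q = q`. -/
theorem mul_insertSum (h : IsRankOneModel φ ι q χ) (hfree : IsFreeFamily φ S)
    {M : List (I × A)} (hM : IsAltWord φ S M) :
    q * insertSum ι q M = q * ι (wordProd M) := by
  cases M with
  | nil => simp [insertSum, h.idem]
  | cons x M =>
    have e := h.wordProd_mul_insertSum hfree (M := M) (V := [x]) hM (by simp)
    simp only [wordProd_cons, wordProd_nil, mul_one] at e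
    rw [insertSum, mul_add, e, add_zero, h.idem_assoc, wordProd_cons]

/-- For `s = u q v` the left factor `u` continues `V` to an alternating word enclosed by two `q`;
here `V` may be empty because `u` is centered. -/
theorem wordProd_mul_mem_centeredSpan (h : IsRankOneModel φ ι q χ) (hfree : IsFreeFamily φ S)
    {V M : List (I × A)} {x : I × A} (hV : IsAltWord φ S (V ++ x :: M)) {s : R}
    (hs : s ∈ centeredSpan φ ι q (S x.1)) : q * (ι (wordProd V) * s) = 0 := by
  induction hs using Submodule.span_induction with
  | mem y hy =>
    obtain ⟨u, hu, v, hv, hu0, hv0, rfl⟩ := hy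
    have h1 : IsAltWord φ S (V ++ [(x.1, u)]) :=
      IsAltWord.of_append_left (M := M) (by simpa using hV.replace (i := x.1) hu hu0)
    have h2 := hfree.wordProd_eq_zero h1 (by simp)
    have e := h.sandwich_assoc (wordProd (V ++ [(x.1, u)])) (ι v)
    rw [h2, zero_smul] at e
    simpa [mul_assoc] using e
  | zero => simp
  | add x y _ _ hx hy => rw [mul_add, mul_add, hx, hy, add_zero]
  | smul c x _ hx => rw [mul_smul_comm, mul_smul_comm, hx, smul_zero]

theorem wordProd_mul_replaceSum (h : IsRankOneModel φ ι q χ) (hfree : IsFreeFamily φ S) :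
    ∀ {L : List ((I × A) × R)} {V : List (I × A)}, IsAltWord φ S (V ++ L.map Prod.fst) →
      (∀ x ∈ L, x.2 ∈ centeredSpan φ ι q (S x.1.1)) →
      q * (ι (wordProd V) * replaceSum ι L) = 0
  | [], V, _, _ => by simp [replaceSum]
  | x :: L, V, hV, hL => by
    have e := h.wordProd_mul_replaceSum hfree (L := L) (V := V ++ [x.1]) (by simpa using hV)
      fun y hy => hL y (by simp [hy])
    simp only [wordProd_append, wordProd_cons, wordProd_nil, mul_one, map_mul, mul_assoc] at e
    have e' := h.wordProd_mul_mem_centeredSpan hfree hV (hL x (by simp))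
    rw [replaceSum, mul_add, mul_add, e, ← mul_assoc (ι _) x.2, ← mul_assoc q, e', zero_mul,
      add_zero]

theorem centered_mul_insertSum (h : IsRankOneModel φ ι q χ) (hfree : IsFreeFamily φ S)
    {M : List (I × A)} {x : I × A} (hM : IsAltWord φ S (x :: M)) {s : R}
    (hs : s ∈ centeredSpan φ ι q (S x.1)) : s * insertSum ι q M = 0 := by
  induction hs using Submodule.span_induction with
  | mem y hy =>
    obtain ⟨u, hu, v, hv, hu0, hv0, rfl⟩ := hy
    have e := h.wordProd_mul_insertSum hfree (M := M) (V := [(x.1, v)])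
      (by simpa using IsAltWord.replace (L := []) (i := x.1) hM hv hv0) (by simp)
    simp only [wordProd_cons, wordProd_nil, mul_one] at e
    rw [mul_assoc, mul_assoc, e, mul_zero]
  | zero => simp
  | add x y _ _ hx hy => rw [add_mul, hx, hy, add_zero]
  | smul c x _ hx => rw [smul_mul_assoc, hx, smul_zero]

theorem centered_mul_replaceSum (h : IsRankOneModel φ ι q χ) (hfree : IsFreeFamily φ S)
    {L : List ((I × A) × R)} {x : I × A} (hM : IsAltWord φ S (x :: L.map Prod.fst))
    (hL : ∀ x ∈ L, x.2 ∈ centeredSpan φ ι q (S x.1.1)) {s : R}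
    (hs : s ∈ centeredSpan φ ι q (S x.1)) : s * replaceSum ι L = 0 := by
  induction hs using Submodule.span_induction with
  | mem y hy =>
    obtain ⟨u, hu, v, hv, hu0, hv0, rfl⟩ := hy
    have e := h.wordProd_mul_replaceSum hfree (L := L) (V := [(x.1, v)])
      (by simpa using IsAltWord.replace (L := []) (i := x.1) hM hv hv0) hL
    simp only [wordProd_cons, wordProd_nil, mul_one] at e
    rw [mul_assoc, mul_assoc, e, mul_zero]
  | zero => simp
  | add x y _ _ hx hy => rw [add_mul, hx, hy, add_zero]
  | smul c x _ hx => rw [smul_mul_assoc, hx, smul_zero]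

/-- The expansion of a product of centered elements of the compressed algebras. -/
theorem prod_compress_add (h : IsRankOneModel φ ι q χ) (hfree : IsFreeFamily φ S) :
    ∀ {L : List ((I × A) × R)}, IsAltWord φ S (L.map Prod.fst) →
      (∀ x ∈ L, x.2 ∈ centeredSpan φ ι q (S x.1.1)) →
      (L.map fun x => compress ι q x.1.2 + x.2).prod * (1 - q) =
        ι (wordProd (L.map Prod.fst)) - insertSum ι q (L.map Prod.fst) + replaceSum ι L
  | [], _, _ => by simp [insertSum, replaceSum]
  | x :: L, hM, hL => by
    have hL' : ∀ x ∈ L, x.2 ∈ centeredSpan φ ι q (S x.1.1) := fun y hy => hL y (by simp [hy])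
    have hx := hL x (by simp)
    rw [List.map_cons] at hM
    have ih := h.prod_compress_add hfree hM.of_cons hL'
    have h1 := h.wordProd_mul_insertSum hfree (V := [x.1]) hM (by simp)
    have h2 := h.mul_insertSum hfree hM.of_cons
    have h3 := h.wordProd_mul_replaceSum hfree (V := [x.1]) hM hL'
    have h4 := h.wordProd_mul_replaceSum hfree (V := []) hM.of_cons hL'
    have h5 := h.centered_mul_insertSum hfree hM hx
    have h6 := h.centered_mul_replaceSum hfree hM hL' hx
    simp only [wordProd_cons, wordProd_nil, mul_one, map_one, one_mul] at h1 h3 h4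
    -- The trailing `1 - q` gives the empty product its corner value `p`, so the induction can start
    -- there. Of the new cross terms, only `q` times the plain word and `q` times the insertions
    -- survive, and `h2` relates these.
    rw [List.map_cons, List.prod_cons, mul_assoc, ih]
    simp only [List.map_cons, insertSum, replaceSum, wordProd_cons, compress, add_mul, sub_mul,
      mul_add, mul_sub, mul_assoc, h1, h2, h3, h4, h5, h6, map_mul, mul_zero]
    abel

/-- By `χ(a q b) = φ(ab)` the position of `q` does not matter, so all `M.length + 1` insertions
contribute equally. -/
theorem map_wordProd_mul_insertSum (h : IsRankOneModel φ ι q χ) :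
    ∀ (M : List (I × A)) (w : A),
      χ (ι w * insertSum ι q M) = (M.length + 1) * φ (w * wordProd M)
  | [], w => by simp [insertSum, h.trace_right]
  | x :: M, w => by
    have e := h.map_wordProd_mul_insertSum M (w * x.2)
    rw [map_mul ι, mul_assoc] at e
    rw [insertSum, mul_add, map_add, e, ← mul_assoc, h.trace]
    simp only [wordProd_cons, mul_assoc, List.length_cons]
    push_cast
    ring

/-- For `s = u q v` the left side is `φ(V u v M)`; freeness extracts the letter `u v` as `φ(u v) =
χ(s)`. -/
theorem map_wordProd_mul_centered (h : IsRankOneModel φ ι q χ) (hφ : φ 1 = 1)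
    (hfree : IsFreeFamily φ S) {V M : List (I × A)} {x : I × A}
    (hV : IsAltWord φ S (V ++ x :: M)) {s : R} (hs : s ∈ centeredSpan φ ι q (S x.1)) :
    χ (ι (wordProd V) * (s * ι (wordProd M))) = χ s * φ (wordProd V * wordProd M) := by
  induction hs using Submodule.span_induction with
  | mem y hy =>
    obtain ⟨u, hu, v, hv, hu0, hv0, rfl⟩ := hy
    have e := h.trace (wordProd V * u) (v * wordProd M)
    have e' := hfree.map_wordProd_mul_mul hφ (i := x.1) (a := x.2) hV ((S x.1).mul_mem hu hv)
    rw [h.trace, ← e']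
    simpa only [map_mul, mul_assoc] using e
  | zero => simp
  | add x y _ _ hx hy => simp only [add_mul, mul_add, map_add, hx, hy]
  | smul c x _ hx =>
    simp only [smul_mul_assoc, mul_smul_comm, map_smul, hx, smul_eq_mul, mul_assoc]

theorem map_wordProd_mul_replaceSum (h : IsRankOneModel φ ι q χ) (hφ : φ 1 = 1)
    (hfree : IsFreeFamily φ S) :
    ∀ {L : List ((I × A) × R)} {V : List (I × A)}, IsAltWord φ S (V ++ L.map Prod.fst) →
      (∀ x ∈ L, x.2 ∈ centeredSpan φ ι q (S x.1.1)) →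
      χ (ι (wordProd V) * replaceSum ι L) =
        ∑ k : Fin L.length, χ (L[k].2) * φ (wordProd (V ++ (L.map Prod.fst).take k) *
          wordProd ((L.map Prod.fst).drop (k + 1)))
  | [], V, _, _ => by simp [replaceSum]
  | x :: L, V, hV, hL => by
    have e := h.map_wordProd_mul_replaceSum hφ hfree (L := L) (V := V ++ [x.1])
      (by simpa using hV) fun y hy => hL y (by simp [hy])
    have e' := h.map_wordProd_mul_centered hφ hfree hV (hL x (by simp))
    have e2 : ι (wordProd (V ++ [x.1])) = ι (wordProd V) * ι x.1.2 := by simp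
    rw [e2, mul_assoc] at e
    rw [replaceSum, mul_add, map_add, e, e']
    simp only [List.length_cons]
    rw [Fin.sum_univ_succ]
    simp

/-- The functional `χ` on a product of centered elements of the compressed algebras. -/
theorem map_prod_compress_add (h : IsRankOneModel φ ι q χ) (hφ : φ 1 = 1)
    (hfree : IsFreeFamily φ S) {L : List ((I × A) × R)} (hM : IsAltWord φ S (L.map Prod.fst))
    (hL : ∀ x ∈ L, x.2 ∈ centeredSpan φ ι q (S x.1.1)) (hne : L ≠ []) :
    χ ((L.map fun x => compress ι q x.1.2 + x.2).prod * (1 - q)) =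
      ∑ k : Fin L.length, χ (L[k].2) * φ (wordProd ((L.map Prod.fst).take k) *
          wordProd ((L.map Prod.fst).drop (k + 1))) := by
  have e := h.map_wordProd_mul_insertSum (L.map Prod.fst) 1
  rw [one_mul, hfree.wordProd_eq_zero hM (by simpa using hne), mul_zero, map_one, one_mul] at e
  have e' := h.map_wordProd_mul_replaceSum hφ hfree (V := []) hM hL
  rw [wordProd_nil, map_one, one_mul] at e'
  rw [h.prod_compress_add hfree hM hL, map_add, map_sub, h.map_base, e, e']
  simp

end IsRankOneModel

end RankOne

/-! ### Words given by tuples -/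

section Tuples

/-- A tuple is a palindrome around the position `k` iff the part before `k`, read backwards, is the
part after `k`. -/
theorem reverse_take_eq_drop_iff {A I : Type*} {n : ℕ} (i : Fin n → I) (a : Fin n → A)
    (k : Fin n) :
    ((List.ofFn fun k => (i k, a k)).take k).reverse.map Prod.fst =
        ((List.ofFn fun k => (i k, a k)).drop (k + 1)).map Prod.fst ↔
      n = 2 * k + 1 ∧ ∀ j, i j = i j.rev := by
  obtain ⟨k, hk⟩ := k
  constructor
  · intro h
    have hl := congrArg List.length h
    simp at hl
    have hn : n = 2 * k + 1 := by omega
    have key : ∀ j (hj : j < k), i ⟨j, by omega⟩ = i ⟨n - 1 - j, by omega⟩ := by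
      intro j hj
      -- Entry `k - 1 - j` of the reversed prefix is letter `j`, and that of the suffix is letter
      -- `2k - j = n - 1 - j`.
      have := List.getElem_of_eq h (i := k - 1 - j) (by simp; omega)
      simp only [List.getElem_map, List.getElem_reverse, List.getElem_take, List.getElem_drop,
        List.getElem_ofFn, List.length_take, List.length_ofFn] at this
      convert this using 3 <;> omega
    refine ⟨hn, fun j => ?_⟩
    rcases lt_trichotomy j.1 k with hj | hj | hj
    · rw [key j hj]
      congr 1
      ext
      simp [Fin.val_rev]
      omega
    · congr 1
      ext
      simp [Fin.val_rev]
      omega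
    · have := key (n - 1 - j) (by omega)
      rw [eq_comm]
      convert this using 2 <;> ext <;> simp [Fin.val_rev] <;> omega
  · rintro ⟨hn, hi⟩
    dsimp only at hn
    apply List.ext_getElem
    · simp
      omega
    · intro m h1 h2
      simp at h1 h2
      simp only [List.getElem_map, List.getElem_reverse, List.getElem_take, List.getElem_drop,
        List.getElem_ofFn, List.length_take, List.length_ofFn]
      rw [hi]
      congr 1
      ext
      simp [Fin.val_rev]
      omega

variable {A I : Type*} [Ring A] [Algebra ℂ A] {φ : A →ₗ[ℂ] ℂ} {S : I → Subalgebra ℂ A}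

theorem IsAltWord.ofFn {n : ℕ} {i : Fin n → I} {a : Fin n → A}
    (hi : ∀ (k : ℕ) (hk : k + 1 < n), i ⟨k, by omega⟩ ≠ i ⟨k + 1, hk⟩)
    (ha : ∀ k, a k ∈ S (i k)) (ha0 : ∀ k, φ (a k) = 0) :
    IsAltWord φ S (List.ofFn fun k => (i k, a k)) where
  chain := by
    rw [List.isChain_iff_getElem]
    intro k hk
    simpa using hi k (by simpa using hk)
  mem x hx := by
    obtain ⟨k, rfl⟩ := (List.mem_ofFn' _ _).1 hx
    exact ha k
  centered x hx := by
    obtain ⟨k, rfl⟩ := (List.mem_ofFn' _ _).1 hx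
    exact ha0 k

theorem prod_zipWith_reverse_take {n : ℕ} (i : Fin n → I) (a : Fin n → A) (k : Fin n)
    (hn : n = 2 * k + 1) (φ : A →ₗ[ℂ] ℂ) :
    (List.zipWith (fun x y => φ (x.2 * y.2)) ((List.ofFn fun k => (i k, a k)).take k).reverse
        ((List.ofFn fun k => (i k, a k)).drop (k + 1))).prod =
      ∏ j : Fin (n / 2), φ (a ⟨j, by omega⟩ * a (Fin.rev ⟨j, by omega⟩)) := by
  obtain ⟨k, hk⟩ := k
  dsimp only at hn
  -- The zipped list runs from the centre outwards, the product over `Fin (n / 2)` from the ends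
  -- inwards.
  rw [← Equiv.prod_comp Fin.revPerm, ← List.prod_ofFn]
  congr 1
  apply List.ext_getElem
  · simp
    omega
  · intro m h1 h2
    simp at h1 h2
    simp only [List.getElem_zipWith, List.getElem_reverse, List.getElem_take, List.getElem_drop,
      List.getElem_ofFn, List.length_take, List.length_ofFn, Fin.revPerm_apply]
    congr 3
    · ext
      simp [Fin.val_rev]
      omega
    · ext
      simp [Fin.val_rev]
      omega

open Classical in
/-- The value of `φ` on an alternating word from which one letter was removed. -/
theorem IsFreeFamily.map_wordProd_take_mul_drop (hφ : φ 1 = 1) (hfree : IsFreeFamily φ S) {n : ℕ}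
    {i : Fin n → I} {a : Fin n → A} (h : IsAltWord φ S (List.ofFn fun k => (i k, a k)))
    (k : Fin n) :
    φ (wordProd ((List.ofFn fun k => (i k, a k)).take k) *
        wordProd ((List.ofFn fun k => (i k, a k)).drop (k + 1))) =
      if n = 2 * k + 1 ∧ ∀ j, i j = i j.rev then
        ∏ j : Fin (n / 2), φ (a ⟨j, by omega⟩ * a (Fin.rev ⟨j, by omega⟩)) else 0 := by
  have e := hfree.map_wordProd_reverse_mul hφ
    (P := ((List.ofFn fun k => (i k, a k)).take k).reverse)
    (Q := (List.ofFn fun k => (i k, a k)).drop (k + 1))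
    (IsAltWord.reverse (IsAltWord.of_append_left
      (M := (List.ofFn fun k => (i k, a k)).drop k) (by simpa using h)))
    (IsAltWord.of_append_right
      (L := (List.ofFn fun k => (i k, a k)).take (k + 1)) (by rwa [List.take_append_drop]))
  rw [List.reverse_reverse] at e
  rw [e]
  simp only [reverse_take_eq_drop_iff]
  split_ifs with hc
  · exact prod_zipWith_reverse_take i a k hc.1 φ
  · rfl

end Tuples

/-! ### The palindrome formula for `χ` -/

section RankOne

variable {A R I : Type*} [Ring A] [Algebra ℂ A] [Ring R] [Algebra ℂ R]
  {φ : A →ₗ[ℂ] ℂ} {ι : A →ₐ[ℂ] R} {q : R} {χ : R →ₗ[ℂ] ℂ} {S : I → Subalgebra ℂ A}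

open Classical in
/-- The infinitesimal part of a product of centered elements of the compressed algebras. -/
theorem IsRankOneModel.map_prod_ofFn (h : IsRankOneModel φ ι q χ) (hφ : φ 1 = 1)
    (hfree : IsFreeFamily φ S) {n : ℕ} (hn : 0 < n) {i : Fin n → I} {a : Fin n → A}
    {s : Fin n → R} (ha : IsAltWord φ S (List.ofFn fun k => (i k, a k)))
    (hs : ∀ k, s k ∈ centeredSpan φ ι q (S (i k))) :
    χ ((List.ofFn fun k => compress ι q (a k) + s k).prod * (1 - q)) =
      if Odd n ∧ ∀ j, i j = i j.rev then
        (∏ j : Fin (n / 2), φ (a ⟨j, by omega⟩ * a (Fin.rev ⟨j, by omega⟩))) *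
          χ (s ⟨n / 2, by omega⟩) else 0 := by
  have hM : (List.ofFn fun k => ((i k, a k), s k)).map Prod.fst =
      List.ofFn fun k => (i k, a k) := by
    rw [List.map_ofFn]; rfl
  have e := h.map_prod_compress_add hφ hfree (L := List.ofFn fun k => ((i k, a k), s k))
    (by rwa [hM]) (fun x hx => by
      obtain ⟨k, rfl⟩ := (List.mem_ofFn' _ _).1 hx
      exact hs k) (by simpa using hn.ne')
  have hl : (List.ofFn fun k => ((i k, a k), s k)).length = n := by simp
  rw [List.map_ofFn] at e
  refine e.trans ?_
  rw [hM]
  rw [← Equiv.sum_comp (finCongr hl.symm)]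
  have hterm : ∀ k : Fin n,
      χ ((List.ofFn fun k => ((i k, a k), s k))[finCongr hl.symm k].2) *
        φ (wordProd ((List.ofFn fun k => (i k, a k)).take (finCongr hl.symm k)) *
          wordProd ((List.ofFn fun k => (i k, a k)).drop (finCongr hl.symm k + 1))) =
      χ (s k) * if n = 2 * k + 1 ∧ ∀ j, i j = i j.rev then
        ∏ j : Fin (n / 2), φ (a ⟨j, by omega⟩ * a (Fin.rev ⟨j, by omega⟩)) else 0 := by
    intro k
    rw [← hfree.map_wordProd_take_mul_drop hφ ha k]
    simp
  rw [Finset.sum_congr rfl fun k _ => hterm k]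
  split_ifs with hc
  · obtain ⟨m, hm⟩ := hc.1
    rw [Finset.sum_eq_single ⟨n / 2, by omega⟩]
    · rw [if_pos ⟨by simp; omega, hc.2⟩, mul_comm]
    · intro k _ hk
      rw [if_neg, mul_zero]
      rintro ⟨h1, -⟩
      exact hk (Fin.ext (by simp; omega))
    · simp
  · refine Finset.sum_eq_zero fun k _ => ?_
    rw [if_neg, mul_zero]
    rintro ⟨h1, h2⟩
    exact hc ⟨⟨k, h1⟩, h2⟩

end RankOne

/-! ### The quotient of the algebra generated by `A` and `q` -/

namespace BPrimeAlg

section Quotient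

variable {A F : Type*} [Ring A] [Algebra ℂ A]
    [NonUnitalRing F] [Module ℂ F] [SMulCommClass ℂ F F] [IsScalarTower ℂ F F]
    [Module A F] [Module Aᵐᵒᵖ F] [SMulCommClass A Aᵐᵒᵖ F]
    [IsScalarTower ℂ A F] [IsScalarTower ℂ Aᵐᵒᵖ F] [IsBimoduleAlgebra A F]

/-- The projection `a + f ↦ a` as a homomorphism of algebras. -/
def mainHom : BPrimeAlg A F →ₐ[ℂ] A :=
  AlgHom.ofLinearMap ⟨⟨main, fun _ _ => rfl⟩, fun _ _ => rfl⟩ rfl fun _ _ => rfl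

/-- The embedding `a ↦ a + 0` as a homomorphism of algebras. -/
def inlHom : A →ₐ[ℂ] BPrimeAlg A F :=
  AlgHom.ofLinearMap ⟨⟨inl, fun _ _ => by ext <;> simp [inl]⟩, fun _ _ => by ext <;> simp [inl]⟩
    rfl fun _ _ => by ext <;> simp [inl]

/-- The word `a₀ q a₁ q ⋯ q aₙ`. -/
def qWord (q : F) (a : A) (l : List A) : BPrimeAlg A F :=
  inlHom a * (l.map fun b => inr q * inlHom b).prod

theorem qWord_mul_qWord (q : F) (a c b : A) (l r : List A) :
    qWord q a l * (inr q * inlHom c * (inr q * qWord q b r)) = qWord q a (l ++ c :: b :: r) := by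
  simp [qWord, mul_assoc]

theorem qWord_mul_qWord' (q : F) (a b : A) (l r : List A) :
    qWord q a l * (inr q * qWord q b r) = qWord q a (l ++ b :: r) := by
  simp [qWord, mul_assoc]

/-- The subalgebra generated by `A` and `q`. -/
def adjoinElem (A : Type*) {F : Type*} [Ring A] [Algebra ℂ A]
    [NonUnitalRing F] [Module ℂ F] [SMulCommClass ℂ F F] [IsScalarTower ℂ F F]
    [Module A F] [Module Aᵐᵒᵖ F] [SMulCommClass A Aᵐᵒᵖ F]
    [IsScalarTower ℂ A F] [IsScalarTower ℂ Aᵐᵒᵖ F] [IsBimoduleAlgebra A F] (q : F) :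
    Subalgebra ℂ (BPrimeAlg A F) :=
  Algebra.adjoin ℂ (Set.range inlHom ∪ {inr q})

theorem inlHom_mem (q : F) (a : A) : inlHom a ∈ adjoinElem A q :=
  Algebra.subset_adjoin (Or.inl ⟨a, rfl⟩)

theorem inr_mem (q : F) : inr q ∈ adjoinElem A q :=
  Algebra.subset_adjoin (Or.inr rfl)

theorem mem_span_qWord (q : F) {x : BPrimeAlg A F} (hx : x ∈ adjoinElem A q) :
    x ∈ Submodule.span ℂ {y | ∃ a l, y = qWord q a l} := by
  have : Subalgebra.toSubmodule (adjoinElem A q) ≤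
      Submodule.span ℂ {y | ∃ a l, y = qWord q a l} := by
    rw [adjoinElem, Algebra.adjoin_eq_span]
    refine Submodule.span_mono fun y hy => ?_
    induction hy using Submonoid.closure_induction_left with
    | one => exact ⟨1, [], by simp [qWord]⟩
    | mul_left x hx y _ ih =>
      obtain ⟨b, l, rfl⟩ := ih
      rcases hx with ⟨c, rfl⟩ | rfl
      · exact ⟨c * b, l, by simp [qWord, mul_assoc]⟩
      · exact ⟨1, b :: l, by simp [qWord, mul_assoc]⟩
  exact this hx

variable {φ : A →ₗ[ℂ] ℂ} {Φ : F →ₗ[ℂ] ℂ} {q : F}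

/-- Cyclic-antimonotone independence with every `fₖ = q`, where `Φ` of the power of `q` is `Φ(q) =
1`. Writing the letters as `l ++ [b]` separates the last one, which pairs with `a`, from the inner
ones. -/
theorem phi'_qWord (hq : q * q = q) (hΦq : Φ q = 1)
    (hcm : IsCyclicAntimonotone φ Φ (⊤ : Subalgebra ℂ A) (NonUnitalAlgebra.adjoin ℂ {q}))
    (a b : A) (l : List A) :
    phi' Φ (qWord q a (l ++ [b])) = φ (a * b) * (l.map φ).prod := by
  have h := hcm l.length (Fin.cons a fun k => (l ++ [b])[k]'(by simp; omega)) (fun _ => q)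
    (fun _ => Algebra.mem_top) (fun _ => NonUnitalAlgebra.subset_adjoin ℂ rfl)
  have hpow : ∀ n : ℕ,
      (List.ofFn fun _ : Fin (n + 1) => (inr q : BPrimeAlg A F)).prod = inr q := by
    have hi : IsIdempotentElem (inr q : BPrimeAlg A F) := by
      ext <;> simp [inr, hq]
    intro n
    rw [List.ofFn_const, List.prod_replicate, hi.pow_succ_eq]
  rw [hpow] at h
  have e1 : (List.ofFn fun k : Fin (l.length + 1) =>
      (inr q * inl ((Fin.cons a fun k => (l ++ [b])[k]'(by simp; omega) :
        Fin (l.length + 2) → A) k.succ) :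
        BPrimeAlg A F)) = (l ++ [b]).map fun b => inr q * inlHom b := by
    apply List.ext_getElem
    · simp
    · intro m h1 h2
      simp only [List.getElem_ofFn, List.getElem_map, Fin.cons_succ]
      rfl
  rw [e1] at h
  have e2 : (∏ k : Fin l.length,
      φ ((Fin.cons a fun k => (l ++ [b])[k]'(by simp; omega) :
        Fin (l.length + 2) → A) k.castSucc.succ)) =
      (l.map φ).prod := by
    rw [← List.prod_ofFn]
    congr 1
    apply List.ext_getElem
    · simp
    · intro m h1 h2
      simp at h1 h2
      simp
  rw [e2] at h
  have e3 : (Fin.cons a fun k => (l ++ [b])[k]'(by simp; omega) : Fin (l.length + 2) → A)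
      (Fin.last (l.length + 1)) = b := by
    rw [← Fin.succ_last, Fin.cons_succ]
    simp
  rw [e3, Fin.cons_zero] at h
  have e4 : phi' Φ (inr q : BPrimeAlg A F) = 1 := hΦq
  rw [e4, mul_one] at h
  exact h

/-- The defining relation `q c q = φ(c) q` holds under `Φ`. -/
theorem phi'_sandwich (hq : q * q = q) (hΦq : Φ q = 1)
    (hcm : IsCyclicAntimonotone φ Φ (⊤ : Subalgebra ℂ A) (NonUnitalAlgebra.adjoin ℂ {q}))
    (c : A) {y z : BPrimeAlg A F} (hy : y ∈ adjoinElem A q) (hz : z ∈ adjoinElem A q) :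
    phi' Φ (y * (inr q * inlHom c * (inr q * z))) = φ c * phi' Φ (y * (inr q * z)) := by
  replace hy := mem_span_qWord q hy
  replace hz := mem_span_qWord q hz
  induction hy using Submodule.span_induction with
  | mem y hy =>
    obtain ⟨a, l, rfl⟩ := hy
    induction hz using Submodule.span_induction with
    | mem z hz =>
      obtain ⟨b, r, rfl⟩ := hz
      rw [qWord_mul_qWord, qWord_mul_qWord']
      -- Exposing the last letter `d` shows that `c` is always an inner letter, so it contributes
      -- exactly the factor `φ(c)`.
      obtain ⟨r', d, hr⟩ : ∃ r' d, b :: r = r' ++ [d] :=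
        ⟨_, _, (List.dropLast_append_getLast (List.cons_ne_nil b r)).symm⟩
      rw [hr, ← List.cons_append, ← List.append_assoc, ← List.append_assoc,
        phi'_qWord hq hΦq hcm, phi'_qWord hq hΦq hcm]
      simp only [List.map_append, List.map_cons, List.prod_append, List.prod_cons]
      ring
    | zero => simp
    | add x y _ _ hx hy => simp only [mul_add, map_add, hx, hy]
    | smul t x _ hx => simp only [mul_smul_comm, map_smul, smul_eq_mul, hx]; ring
  | zero => simp
  | add x y _ _ hx hy => simp only [add_mul, mul_add, map_add, hx, hy]
  | smul t x _ hx => simp only [smul_mul_assoc, map_smul, smul_eq_mul, hx]; ring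

/-- The ideal of the elements of `F` in the algebra generated by `A` and `q` that are invisible to
`Φ`. -/
def nullIdeal (A : Type*) {F : Type*} [Ring A] [Algebra ℂ A]
    [NonUnitalRing F] [Module ℂ F] [SMulCommClass ℂ F F] [IsScalarTower ℂ F F]
    [Module A F] [Module Aᵐᵒᵖ F] [SMulCommClass A Aᵐᵒᵖ F]
    [IsScalarTower ℂ A F] [IsScalarTower ℂ Aᵐᵒᵖ F] [IsBimoduleAlgebra A F]
    (Φ : F →ₗ[ℂ] ℂ) (q : F) : Ideal (adjoinElem A q) where
  -- The first condition lets the projection to `A` descend to the quotient; multipliers on both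
  -- sides make the ideal two-sided.
  carrier := {x | mainHom (x : BPrimeAlg A F) = 0 ∧
    ∀ y z : adjoinElem A q, phi' Φ (y * x * z : BPrimeAlg A F) = 0}
  add_mem' := fun {a b} ha hb => ⟨by simp [ha.1, hb.1], fun y z => by
    simp only [Subalgebra.coe_add, mul_add, add_mul, map_add, ha.2 y z, hb.2 y z, add_zero]⟩
  zero_mem' := ⟨by simp, fun y z => by simp⟩
  smul_mem' := fun c x hx => ⟨by simp [hx.1], fun y z => by
    have := hx.2 (y * c) z
    simpa [mul_assoc] using this⟩

instance : (nullIdeal A Φ q).IsTwoSided :=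
  ⟨fun {a} b ha => ⟨by simp [ha.1], fun y z => by
    have := ha.2 y (b * z)
    simpa [mul_assoc] using this⟩⟩

/-- The quotient of the algebra generated by `A` and `q`. -/
def NullQuotient (A : Type*) {F : Type*} [Ring A] [Algebra ℂ A]
    [NonUnitalRing F] [Module ℂ F] [SMulCommClass ℂ F F] [IsScalarTower ℂ F F]
    [Module A F] [Module Aᵐᵒᵖ F] [SMulCommClass A Aᵐᵒᵖ F]
    [IsScalarTower ℂ A F] [IsScalarTower ℂ Aᵐᵒᵖ F] [IsBimoduleAlgebra A F]
    (Φ : F →ₗ[ℂ] ℂ) (q : F) : Type _ := adjoinElem A q ⧸ nullIdeal A Φ q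

instance : Ring (NullQuotient A Φ q) :=
  Ideal.Quotient.ring (nullIdeal A Φ q)

instance : Algebra ℂ (NullQuotient A Φ q) :=
  Ideal.Quotient.algebra ℂ (I := nullIdeal A Φ q)

/-- The quotient map. -/
def nullMk (Φ : F →ₗ[ℂ] ℂ) (q : F) : adjoinElem A q →ₐ[ℂ] NullQuotient A Φ q :=
  Ideal.Quotient.mkₐ ℂ (nullIdeal A Φ q)

theorem nullMk_surjective (Φ : F →ₗ[ℂ] ℂ) (q : F) :
    Function.Surjective (nullMk (A := A) Φ q) :=
  Ideal.Quotient.mk_surjective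

/-- The functional induced by `Φ` on the quotient. -/
def nullPhi' (Φ : F →ₗ[ℂ] ℂ) (q : F) : NullQuotient A Φ q →ₗ[ℂ] ℂ where
  toFun := Quotient.lift (fun x : adjoinElem A q => phi' Φ (x : BPrimeAlg A F)) fun x y hxy => by
    -- The multipliers `y = z = 1` show that `Φ` itself vanishes on the ideal.
    have h := ((Submodule.quotientRel_def _).1 hxy).2 1 1
    simpa [sub_eq_zero] using h
  map_add' x y := by
    obtain ⟨x, rfl⟩ := nullMk_surjective Φ q x
    obtain ⟨y, rfl⟩ := nullMk_surjective Φ q y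
    exact map_add (phi' Φ) x.1 y.1
  map_smul' c x := by
    obtain ⟨x, rfl⟩ := nullMk_surjective Φ q x
    exact map_smul (phi' Φ) c x.1

theorem nullPhi'_nullMk (x : adjoinElem A q) :
    nullPhi' Φ q (nullMk Φ q x) = phi' Φ (x : BPrimeAlg A F) := rfl

/-- The image of `A` in the quotient. -/
def nullInl (Φ : F →ₗ[ℂ] ℂ) (q : F) : A →ₐ[ℂ] NullQuotient A Φ q :=
  (nullMk Φ q).comp (inlHom.codRestrict _ (inlHom_mem q))

/-- The projection to `A` on the quotient. -/
def nullMain (Φ : F →ₗ[ℂ] ℂ) (q : F) : NullQuotient A Φ q →ₐ[ℂ] A :=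
  Ideal.Quotient.liftₐ (nullIdeal A Φ q) (mainHom.comp (adjoinElem A q).val) fun _ hx => hx.1

theorem nullMain_nullMk (x : adjoinElem A q) :
    nullMain Φ q (nullMk Φ q x) = (x : BPrimeAlg A F).main := rfl

theorem nullMain_nullInl (a : A) : nullMain Φ q (nullInl Φ q a) = a := rfl

theorem nullMain_centeredSpan {T : Subalgebra ℂ A} {s : NullQuotient A Φ q}
    (hs : s ∈ centeredSpan φ (nullInl Φ q) (nullMk Φ q ⟨inr q, inr_mem q⟩) T) :
    nullMain Φ q s = 0 := by
  have h0 : nullMain Φ q (nullMk Φ q ⟨inr q, inr_mem (A := A) q⟩) = 0 := rfl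
  induction hs using Submodule.span_induction with
  | mem y hy =>
    obtain ⟨u, -, v, -, -, -, rfl⟩ := hy
    simp [h0]
  | zero => simp
  | add x y _ _ hx hy => rw [map_add, hx, hy, add_zero]
  | smul c x _ hx => rw [map_smul, hx, smul_zero]

theorem isRankOneModel_nullMk (hq : q * q = q) (hΦq : Φ q = 1)
    (hcm : IsCyclicAntimonotone φ Φ (⊤ : Subalgebra ℂ A) (NonUnitalAlgebra.adjoin ℂ {q})) :
    IsRankOneModel φ (nullInl Φ q) (nullMk Φ q ⟨inr q, inr_mem q⟩) (nullPhi' Φ q) where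
  idem := by
    rw [← map_mul]
    congr 1
    ext <;> simp [inr, hq]
  sandwich a := by
    change nullMk Φ q (⟨inr q, inr_mem q⟩ * ⟨inlHom a, inlHom_mem q a⟩ * ⟨inr q, inr_mem q⟩) =
      _
    rw [← map_smul]
    refine (Ideal.Quotient.eq).2 ⟨?_, fun y z => ?_⟩
    · change 0 * a * 0 - φ a • (0 : A) = 0
      simp
    have e := phi'_sandwich hq hΦq hcm a y.2 z.2
    simp only [Subalgebra.coe_sub, Subalgebra.coe_mul, Subalgebra.coe_smul, mul_sub, sub_mul,
      map_sub, mul_smul_comm, smul_mul_assoc, map_smul, smul_eq_mul, mul_assoc] at e ⊢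
    rw [e, sub_self]
  map_base a := map_zero Φ
  trace a b := by
    have e := phi'_qWord hq hΦq hcm a b []
    simp only [List.nil_append, List.map_nil, List.prod_nil, mul_one] at e
    rw [← e]
    change phi' Φ (inlHom a * inr q * inlHom b : BPrimeAlg A F) = _
    simp [qWord, mul_assoc]

end Quotient

end BPrimeAlg

/-! ### The compressed algebras -/

/-- The final `p` is needed for the empty list, whose product in the corner is `p` and not 1. -/
theorem IsIdempotentElem.coe_corner_list_prod_mul {B : Type*} [Ring B] {p : B}
    (hp : IsIdempotentElem p) : ∀ L : List hp.Corner,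
      L.prod.1 = (L.map fun x => x.1).prod * p
  | [] => (one_mul p).symm
  | x :: L => by
    rw [List.prod_cons, List.map_cons, List.prod_cons, mul_assoc,
      ← hp.coe_corner_list_prod_mul L]
    rfl

namespace BPrimeAlg

section Corner

variable {A F I : Type*} [Ring A] [Algebra ℂ A]
    [NonUnitalRing F] [Module ℂ F] [SMulCommClass ℂ F F] [IsScalarTower ℂ F F]
    [Module A F] [Module Aᵐᵒᵖ F] [SMulCommClass A Aᵐᵒᵖ F]
    [IsScalarTower ℂ A F] [IsScalarTower ℂ Aᵐᵒᵖ F] [IsBimoduleAlgebra A F]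
    {φ : A →ₗ[ℂ] ℂ} {Φ : F →ₗ[ℂ] ℂ} {q : F} {T : Subalgebra ℂ A}

theorem isCornerForm_of_mem_cornerSubalgebra (hφ : φ 1 = 1) (hq : q * q = q) (hΦq : Φ q = 1)
    (hcm : IsCyclicAntimonotone φ Φ (⊤ : Subalgebra ℂ A) (NonUnitalAlgebra.adjoin ℂ {q}))
    {x : (isIdempotentElem_one_sub_inr (A := A) hq).Corner}
    (hx : x ∈ cornerSubalgebra (isIdempotentElem_one_sub_inr hq) (inl '' (T : Set A))) :
    ∃ hxq : x.1 ∈ adjoinElem A q,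
      IsCornerForm φ (nullInl Φ q) (nullMk Φ q ⟨inr q, inr_mem q⟩) T (nullMk Φ q ⟨x.1, hxq⟩) := by
  have h := isRankOneModel_nullMk hq hΦq hcm
  have hp : (1 - inr q : BPrimeAlg A F) ∈ adjoinElem A q :=
    sub_mem (one_mem _) (inr_mem q)
  induction hx using Algebra.adjoin_induction with
  | mem x hx =>
    obtain ⟨_, ⟨a, ha, rfl⟩, hx⟩ := hx
    have e := IsCornerForm.conj h hφ ha
    have hm : x.1 ∈ adjoinElem A q := by
      rw [hx]
      exact mul_mem (mul_mem hp (inlHom_mem q a)) hp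
    refine ⟨hm, ?_⟩
    convert e using 1
    have : (⟨x.1, hm⟩ : adjoinElem A q) =
        (1 - ⟨inr q, inr_mem q⟩) * ⟨inlHom a, inlHom_mem q a⟩ * (1 - ⟨inr q, inr_mem q⟩) :=
      Subtype.ext hx
    rw [this]
    simp only [map_mul, map_sub, map_one]
    rfl
  | algebraMap c =>
    have e : (algebraMap ℂ (isIdempotentElem_one_sub_inr (A := A) hq).Corner c).1 =
        c • (1 - inr q : BPrimeAlg A F) := by
      rw [Algebra.algebraMap_eq_smul_one]
      rfl
    have hm : (algebraMap ℂ (isIdempotentElem_one_sub_inr (A := A) hq).Corner c).1 ∈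
        adjoinElem A q := by
      rw [e]
      exact Subalgebra.smul_mem _ hp c
    refine ⟨hm, ?_⟩
    have e' : (⟨_, hm⟩ : adjoinElem A q) = c • (1 - ⟨inr q, inr_mem q⟩) := Subtype.ext e
    rw [e', map_smul, map_sub, map_one]
    exact IsCornerForm.smul_one_sub c
  | add x y _ _ hx hy =>
    obtain ⟨h1, h2⟩ := hx
    obtain ⟨h3, h4⟩ := hy
    refine ⟨add_mem h1 h3, ?_⟩
    have e := h2.add h4
    rw [← map_add] at e
    exact e
  | mul x y _ _ hx hy =>
    obtain ⟨h1, h2⟩ := hx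
    obtain ⟨h3, h4⟩ := hy
    refine ⟨mul_mem h1 h3, ?_⟩
    have e := h2.mul h hφ h4
    rw [← map_mul] at e
    exact e

/-- Centered elements of the compressed algebra of `T` in the quotient. -/
theorem exists_nullMk_eq_compress_add (hφ : φ 1 = 1) (hq : q * q = q) (hΦq : Φ q = 1)
    (hcm : IsCyclicAntimonotone φ Φ (⊤ : Subalgebra ℂ A) (NonUnitalAlgebra.adjoin ℂ {q}))
    {x : (isIdempotentElem_one_sub_inr (A := A) hq).Corner}
    (hx : x ∈ cornerSubalgebra (isIdempotentElem_one_sub_inr hq) (inl '' (T : Set A)))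
    (hx0 : φ x.1.main = 0) :
    x.1.main ∈ T ∧ ∃ hxq : x.1 ∈ adjoinElem A q,
      ∃ s ∈ centeredSpan φ (nullInl Φ q) (nullMk Φ q ⟨inr q, inr_mem q⟩) T,
        nullMk Φ q ⟨x.1, hxq⟩ =
          compress (nullInl Φ q) (nullMk Φ q ⟨inr q, inr_mem q⟩) x.1.main + s := by
  obtain ⟨hxq, c, a, s, ha, ha0, hs, e⟩ :=
    isCornerForm_of_mem_cornerSubalgebra hφ hq hΦq hcm hx
  have hq0 : nullMain Φ q (nullMk Φ q ⟨inr q, inr_mem (A := A) q⟩) = 0 := rfl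
  have hmain : x.1.main = c • 1 + a := by
    -- The projection to `A` kills `q` and `s`, leaving `c + a`; centering then forces `c = 0`.
    have := congrArg (nullMain Φ q) e
    rw [nullMain_nullMk] at this
    simpa [compress, hq0, nullMain_nullInl, nullMain_centeredSpan hs] using this
  have hc : c = 0 := by simpa [hmain, hφ, ha0] using hx0
  subst hc
  rw [zero_smul, zero_add] at hmain e
  rw [hmain]
  exact ⟨ha, hxq, s, hs, e⟩

end Corner

end BPrimeAlg

end

/-! ### Infinitesimal freeness of the compressed family -/

theorem proposition5p3 {A F I : Type*}
    [Ring A] [Algebra ℂ A]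
    [NonUnitalRing F] [Module ℂ F] [SMulCommClass ℂ F F] [IsScalarTower ℂ F F]
    [Module A F] [Module Aᵐᵒᵖ F] [SMulCommClass A Aᵐᵒᵖ F]
    [IsScalarTower ℂ A F] [IsScalarTower ℂ Aᵐᵒᵖ F] [IsBimoduleAlgebra A F]
    (φ : A →ₗ[ℂ] ℂ) (hφ : φ 1 = 1) (Φ : F →ₗ[ℂ] ℂ)
    (q : F) (hq : q * q = q) (hΦq : Φ q = 1)
    (hcm : IsCyclicAntimonotone φ Φ (⊤ : Subalgebra ℂ A) (NonUnitalAlgebra.adjoin ℂ {q}))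
    (S : I → Subalgebra ℂ A) (hfree : IsFreeFamily φ S)
    -- `p B p` with `p = 1 - q`, and the functionals `ψ = φ`, `ψ' = φ + φ'` on it
    (ψ ψ' : (BPrimeAlg.isIdempotentElem_one_sub_inr (A := A) hq).Corner →ₗ[ℂ] ℂ)
    (hψ : ψ = cornerRestrict (BPrimeAlg.isIdempotentElem_one_sub_inr hq) (BPrimeAlg.phi φ))
    (hψ' : ψ' = cornerRestrict (BPrimeAlg.isIdempotentElem_one_sub_inr hq)
      (BPrimeAlg.phi φ + BPrimeAlg.phi' Φ)) :
    IsInfinitesimalNCPS ψ ψ' ∧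
      IsInfinitesimallyFree ψ ψ' (fun i =>
        cornerSubalgebra (BPrimeAlg.isIdempotentElem_one_sub_inr hq)
          (BPrimeAlg.inl '' (S i : Set A))) := by
  subst hψ hψ'
  refine ⟨⟨?_, ?_⟩, ?_⟩
  · change φ (1 - 0) = 1
    rw [sub_zero, hφ]
  · change φ (1 - 0) + Φ (0 - q) = 0
    simp [hφ, hΦq]
  intro n hn i b hi hb hb0
  have h := BPrimeAlg.isRankOneModel_nullMk hq hΦq hcm
  choose hmem hbq s hs e using fun k =>
    BPrimeAlg.exists_nullMk_eq_compress_add hφ hq hΦq hcm (hb k) (hb0 k)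
  have halt : IsAltWord φ S (List.ofFn fun k => (i k, (b k).1.main)) :=
    IsAltWord.ofFn hi hmem hb0
  have hcoe := IsIdempotentElem.coe_corner_list_prod_mul _ (List.ofFn b)
  have hφprod : φ (List.ofFn b).prod.1.main = 0 := by
    have h0 := hfree.wordProd_eq_zero halt (by simpa using hn.ne')
    have e1 : (List.ofFn b).prod.1.main = wordProd (List.ofFn fun k => (i k, (b k).1.main)) := by
      change BPrimeAlg.mainHom (List.ofFn b).prod.1 = _
      rw [hcoe, map_mul, map_list_prod, List.map_map, List.map_ofFn, wordProd, List.map_ofFn,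
        show BPrimeAlg.mainHom (1 - BPrimeAlg.inr q : BPrimeAlg A F) = 1 from sub_zero 1, mul_one]
      rfl
    rw [e1, h0]
  -- The compression `a - q a - a q` of a centered `a` is invisible to `χ`, so `s k` carries the
  -- whole value.
  have hs' : ∀ k, BPrimeAlg.nullPhi' Φ q (s k) = BPrimeAlg.phi' Φ (b k).1 := by
    intro k
    have := congrArg (BPrimeAlg.nullPhi' Φ q) (e k)
    rw [map_add, h.map_compress (hb0 k), zero_add, BPrimeAlg.nullPhi'_nullMk] at this
    exact this.symm
  have key : BPrimeAlg.phi' Φ (List.ofFn b).prod.1 =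
      BPrimeAlg.nullPhi' Φ q ((List.ofFn fun k => compress (BPrimeAlg.nullInl Φ q)
        (BPrimeAlg.nullMk Φ q ⟨BPrimeAlg.inr q, BPrimeAlg.inr_mem q⟩) (b k).1.main + s k).prod *
          (1 - BPrimeAlg.nullMk Φ q ⟨BPrimeAlg.inr q, BPrimeAlg.inr_mem q⟩)) := by
    have e1 : (List.ofFn b).prod.1 =
        (((List.ofFn fun k => (⟨(b k).1, hbq k⟩ : BPrimeAlg.adjoinElem A q)).prod *
          (1 - ⟨BPrimeAlg.inr q, BPrimeAlg.inr_mem q⟩) : BPrimeAlg.adjoinElem A q) :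
            BPrimeAlg A F) := by
      rw [hcoe, Subalgebra.coe_mul, ← Subalgebra.coe_val, map_list_prod, List.map_ofFn,
        List.map_ofFn]
      rfl
    rw [e1, ← BPrimeAlg.nullPhi'_nullMk, map_mul, map_list_prod, List.map_ofFn, map_sub, map_one]
    congr 4
    funext k
    exact e k
  rw [h.map_prod_ofFn hφ hfree hn halt hs, hs'] at key
  refine ⟨hφprod, fun hc => ?_, fun hc => ?_⟩
  · change φ (List.ofFn b).prod.1.main + BPrimeAlg.phi' Φ (List.ofFn b).prod.1 =
      _ * (φ (b ⟨n / 2, _⟩).1.main + BPrimeAlg.phi' Φ (b ⟨n / 2, _⟩).1)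
    rw [hφprod, key, if_pos hc, zero_add, show φ (b ⟨n / 2, by omega⟩).1.main = 0 from hb0 _,
      zero_add]
    rfl
  · change φ (List.ofFn b).prod.1.main + BPrimeAlg.phi' Φ (List.ofFn b).prod.1 = 0
    rw [hφprod, key, if_neg hc, zero_add]
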